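/- Let $\mathcal X,\mathcal U,\mathcal Y$ be complex Hilbert spaces and let $\begin{bmatrix}A\&B\\ C\&D\end{bmatrix}$ be a system node on $(\mathcal X,\mathcal U,\mathcal Y)$, that is: $A\&B:\mathcal X\times\mathcal U\supset\mathrm{dom}(A\&B)\to\mathcal X$ is a closed linear operator; $C\&D:\mathrm{dom}(A\&B)\to\mathcal Y$ is linear and bounded with respect to the graph norm $\|(x,u)\|_{\mathrm{dom}(A\&B)}=(\|x\|^2+\|u\|^2+\|A\&B(x,u)\|^2)^{1/2}$; for every $u\in\mathcal U$ there is $x\in\mathcal X$ with $(x,u)\in\mathrm{dom}(A\&B)$; and the main operator $Ax=A\&B(x,0)$, $\mathrm{dom}(A)=\{x\in\mathcal X:(x,0)\in\mathrm{dom}(A\&B)\}$, generates a strongly continuous semigroup on $\mathcal X$. A classical trajectory on $[0,T]$ ($T>0$) is a triple $(x,u,y)\in C^1([0,T];\mathcal X)\times C([0,T];\mathcal U)\times C([0,T];\mathcal Y)$ such that for all $t\in[0,T]$: $(x(t),u(t))\in\mathrm{dom}(A\&B)$, $\dot x(t)=A\&B(x(t),u(t))$ and $y(t)=C\&D(x(t),u(t))$.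 A generalized trajectory on $[0,T]$ is a limit of classical trajectories on $[0,T]$ in $C([0,T];\mathcal X)\times L^2([0,T];\mathcal U)\times L^2([0,T];\mathcal Y)$. Let $Q=Q^*\in L(\mathcal Y)$, $S\in L(\mathcal U,\mathcal Y)$, $R=R^*\in L(\mathcal U)$ and $$s(y,u)=\left\langle \begin{bmatrix}y\\u\end{bmatrix},\begin{bmatrix}Q&S\\S^*&R\end{bmatrix}\begin{bmatrix}y\\u\end{bmatrix}\right\rangle_{\mathcal Y\times\mathcal U}.$$ Let $\mathcal S:\mathcal X\to\mathbb R$ be a bounded real quadratic form, i.e. $h(x,z)=\tfrac14\big(\mathcal S(x+z)-\mathcal S(x-z)+i\,\mathcal S(x+iz)-i\,\mathcal S(x-iz)\big)$ is sesquilinear (linear in $x$, conjugate-linear in $z$), and there is $c>0$ with $|\mathcal S(x)|\le c\|x\|^2$ for all $x\in\mathcal X$. Let $P=P^*\in L(\mathcal X)$ be the operator induced by $\mathcal S$, i.e. $h(x,z)=\langle x,Pz\rangle$ for all $x,z\in\mathcal X$ (inner products are linear in the first argument). Then the following are equivalent: (i) The system is dissipative with respect to the supply rate $s$ and the storage function $\mathcal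 S$: for all $T>0$ and every classical trajectory $(x,u,y)$ on $[0,T]$, $$\mathcal S(x(T))-\mathcal S(x(0))+\int_0^T s(y(t),u(t))\,dt\ge 0.$$ (ii) There is a subspace $\widetilde{\mathcal W}$ of $\mathrm{dom}(A\&B)$, dense in the graph norm, such that for all $(x,u)\in\widetilde{\mathcal W}$ $$2\,\mathrm{Re}\,\langle Px,A\&B(x,u)\rangle_{\mathcal X}+s(C\&D(x,u),u)\ge 0.$$ (iii) The inequality in (ii) holds for all $(x,u)\in\mathrm{dom}(A\&B)$. (iv) There are a Hilbert space $\mathcal Z$ and a linear operator $K\&L:\mathrm{dom}(A\&B)\to\mathcal Z$, bounded with respect to the graph norm and with dense range, such that for all $(x,u)\in\mathrm{dom}(A\&B)$ $$2\,\mathrm{Re}\,\langle Px,A\&B(x,u)\rangle_{\mathcal X}+s(C\&D(x,u),u)=\|K\&L(x,u)\|_{\mathcal Z}^2.$$ (v) The inequality in (i) holds for all $T>0$ and every generalized trajectory $(x,u,y)$ on $[0,T]$. -/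

import Mathlib

open Filter Topology MeasureTheory
open scoped NNReal ENNReal InnerProductSpace ComplexConjugate

universe u v w

namespace SysNode

section Operators

variable {E F G : Type*} [NormedAddCommGroup E] [NormedSpace ℂ E]
  [NormedAddCommGroup F] [NormedSpace ℂ F] [NormedAddCommGroup G] [NormedSpace ℂ G]

/-- A strongly continuous semigroup of bounded linear operators on `E`. -/
structure C0Semigroup (E : Type*) [NormedAddCommGroup E] [NormedSpace ℂ E] where
  /-- the operator at time `t` -/
  toFun : ℝ≥0 → E →L[ℂ] E
  map_zero : toFun 0 = ContinuousLinearMap.id ℂ E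
  map_add : ∀ s t : ℝ≥0, toFun (s + t) = (toFun s).comp (toFun t)
  continuous_orbit : ∀ x : E, Continuous fun t : ℝ≥0 => toFun t x

/-- `A` is the infinitesimal generator of the semigroup `𝔄`: one has `x ∈ dom A` and `A x = z`
exactly when the difference quotients of the orbit of `x` at time zero converge to `z`. -/
def C0Semigroup.IsGeneratedBy (𝔄 : C0Semigroup E) (A : E →ₗ.[ℂ] E) : Prop :=
  ∀ x z : E, (x, z) ∈ A.graph ↔
    Tendsto (fun t : ℝ≥0 => (t : ℝ)⁻¹ • (𝔄.toFun t x - x)) (𝓝[>] 0) (𝓝 z)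

/-- The graph norm on the domain of an operator from the Hilbert space product `E × F` to `G`.
It is written out, because the norm of the Lean type `E × F` is the maximum norm. -/
noncomputable def graphNorm (A : E × F →ₗ.[ℂ] G) (w : A.domain) : ℝ :=
  √(‖(w : E × F).1‖ ^ 2 + ‖(w : E × F).2‖ ^ 2 + ‖A w‖ ^ 2)

/-- `K` is bounded as an operator on `dom A` with the graph norm. -/
def IsBoundedOnDomain {H : Type*} [NormedAddCommGroup H] [NormedSpace ℂ H]
    (A : E × F →ₗ.[ℂ] G) (K : A.domain →ₗ[ℂ] H) : Prop :=
  ∃ c : ℝ, ∀ w : A.domain, ‖K w‖ ≤ c * graphNorm A w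

/-- The subspace `W` of `dom A` is dense in `dom A` with respect to the graph norm. -/
def IsDenseInDomain (A : E × F →ₗ.[ℂ] G) (W : Submodule ℂ A.domain) : Prop :=
  ∀ w : A.domain, ∀ ε : ℝ, 0 < ε → ∃ w' ∈ W, graphNorm A (w - w') < ε

/-- The main operator of `A&B`: `dom A = {x | (x, 0) ∈ dom A&B}` and `A x = A&B (x, 0)`. -/
def mainOperator (AB : E × F →ₗ.[ℂ] E) : E →ₗ.[ℂ] E where
  domain := AB.domain.comap (LinearMap.inl ℂ E F)
  toFun := AB.toFun.comp
    ((LinearMap.inl ℂ E F).restrict (p := AB.domain.comap (LinearMap.inl ℂ E F))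
      (q := AB.domain) fun _ hx => hx)

end Operators

section Node

variable {X : Type u} {U : Type v} {Y : Type w}
  [NormedAddCommGroup X] [InnerProductSpace ℂ X]
  [NormedAddCommGroup U] [InnerProductSpace ℂ U]
  [NormedAddCommGroup Y] [InnerProductSpace ℂ Y]

/-- A system node on `(X, U, Y)`. -/
structure SystemNode (X : Type u) (U : Type v) (Y : Type w)
    [NormedAddCommGroup X] [InnerProductSpace ℂ X]
    [NormedAddCommGroup U] [InnerProductSpace ℂ U]
    [NormedAddCommGroup Y] [InnerProductSpace ℂ Y] where
  /-- the operator `A&B` -/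
  AB : X × U →ₗ.[ℂ] X
  /-- the operator `C&D`, with the same domain as `A&B` -/
  CD : AB.domain →ₗ[ℂ] Y
  isClosed_AB : AB.IsClosed
  bounded_CD : IsBoundedOnDomain AB CD
  exists_state : ∀ u : U, ∃ x : X, (x, u) ∈ AB.domain
  exists_semigroup : ∃ 𝔄 : C0Semigroup X, 𝔄.IsGeneratedBy (mainOperator AB)

/-- `(x, u, y)` is a classical trajectory on `[0, T]`. Functions on `[0, T]` are
represented by functions on `ℝ` of which only the values on `[0, T]` matter. -/
structure IsClassicalTrajectory (N : SystemNode X U Y) (T : ℝ)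
    (x : ℝ → X) (u : ℝ → U) (y : ℝ → Y) : Prop where
  contDiffOn_x : ContDiffOn ℝ 1 x (Set.Icc 0 T)
  continuousOn_u : ContinuousOn u (Set.Icc 0 T)
  continuousOn_y : ContinuousOn y (Set.Icc 0 T)
  equation : ∀ t ∈ Set.Icc 0 T, ∃ h : (x t, u t) ∈ N.AB.domain,
    HasDerivWithinAt x (N.AB ⟨(x t, u t), h⟩) (Set.Icc 0 T) t ∧ y t = N.CD ⟨(x t, u t), h⟩

/-- `(x, u, y)` is a generalized trajectory on `[0, T]`: a limit of classical
trajectories in `C([0,T]; X) × L²([0,T]; U) × L²([0,T]; Y)`. -/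
structure IsGeneralizedTrajectory (N : SystemNode X U Y) (T : ℝ)
    (x : ℝ → X) (u : ℝ → U) (y : ℝ → Y) : Prop where
  continuousOn_x : ContinuousOn x (Set.Icc 0 T)
  memLp_u : MemLp u 2 (volume.restrict (Set.Icc 0 T))
  memLp_y : MemLp y 2 (volume.restrict (Set.Icc 0 T))
  exists_approx : ∃ (xs : ℕ → ℝ → X) (us : ℕ → ℝ → U) (ys : ℕ → ℝ → Y),
    (∀ n, IsClassicalTrajectory N T (xs n) (us n) (ys n)) ∧
    TendstoUniformlyOn xs x atTop (Set.Icc 0 T) ∧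
    Tendsto (fun n => eLpNorm (us n - u) 2 (volume.restrict (Set.Icc 0 T))) atTop (𝓝 0) ∧
    Tendsto (fun n => eLpNorm (ys n - y) 2 (volume.restrict (Set.Icc 0 T))) atTop (𝓝 0)

/-- The supply rate `s(y, u) = ⟨(y, u), [Q S; S* R] (y, u)⟩` in the Hilbert space `Y × U`.
For self-adjoint `Q` and `R` the inner product is a real number, see `ofReal_supplyRate`. -/
noncomputable def supplyRate [CompleteSpace U] [CompleteSpace Y]
    (Q : Y →L[ℂ] Y) (S : U →L[ℂ] Y) (R : U →L[ℂ] U) (y : Y) (u : U) : ℝ :=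
  (inner ℂ (WithLp.toLp 2 (y, u))
    (WithLp.toLp 2 (Q y + S u, ContinuousLinearMap.adjoint S y + R u))).re

theorem ofReal_supplyRate [CompleteSpace U] [CompleteSpace Y]
    {Q : Y →L[ℂ] Y} (S : U →L[ℂ] Y) {R : U →L[ℂ] U}
    (hQ : IsSelfAdjoint Q) (hR : IsSelfAdjoint R) (y : Y) (u : U) :
    (supplyRate Q S R y u : ℂ) = inner ℂ (WithLp.toLp 2 (y, u))
      (WithLp.toLp 2 (Q y + S u, ContinuousLinearMap.adjoint S y + R u)) := by
  unfold supplyRate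
  rw [← Complex.conj_eq_iff_re, inner_conj_symm]
  simp only [WithLp.prod_inner_apply, inner_add_left, inner_add_right,
    ContinuousLinearMap.adjoint_inner_left, ContinuousLinearMap.adjoint_inner_right]
  have h1 : inner ℂ (Q y) y = inner ℂ y (Q y) := hQ.isSymmetric y y
  have h2 : inner ℂ (R u) u = inner ℂ u (R u) := hR.isSymmetric u u
  rw [h1, h2]
  ring

/-- The form `h(x, z)` obtained from `𝒮` by polarization. -/
noncomputable def polarForm (𝒮 : X → ℝ) (x z : X) : ℂ :=
  (1 / 4 : ℂ) * ((𝒮 (x + z) : ℂ) - (𝒮 (x - z) : ℂ)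
    + Complex.I * (𝒮 (x + Complex.I • z) : ℂ) - Complex.I * (𝒮 (x - Complex.I • z) : ℂ))

/-- `𝒮 : X → ℝ` is a real quadratic form: its polarization is sesquilinear, that is, linear in
the first and conjugate-linear in the second argument. -/
def IsRealQuadraticForm (𝒮 : X → ℝ) : Prop :=
  ∃ h : X →ₗ[ℂ] X →ₗ⋆[ℂ] ℂ, ∀ x z : X, h x z = polarForm 𝒮 x z

/-- `𝒮` is bounded. -/
def IsBoundedForm (𝒮 : X → ℝ) : Prop :=
  ∃ c : ℝ, 0 < c ∧ ∀ x : X, |𝒮 x| ≤ c * ‖x‖ ^ 2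

/-- `P` is the self-adjoint operator induced by `𝒮`, that is, `h(x, z) = ⟨x, P z⟩` for an inner
product that is linear in the first argument (Mathlib's is linear in the second). -/
structure IsInducedOperator [CompleteSpace X] (𝒮 : X → ℝ) (P : X →L[ℂ] X) : Prop where
  isSelfAdjoint : IsSelfAdjoint P
  form_eq : ∀ x z : X, polarForm 𝒮 x z = inner ℂ (P z) x

/-- The dissipation inequality on `[0, T]` for the supply rate `s` and the storage function `𝒮`. -/
def DissipationInequality (s : Y → U → ℝ) (𝒮 : X → ℝ) (T : ℝ)
    (x : ℝ → X) (u : ℝ → U) (y : ℝ → Y) : Prop :=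
  0 ≤ 𝒮 (x T) - 𝒮 (x 0) + ∫ t in (0 : ℝ)..T, s (y t) (u t)

/-- The system is dissipative with respect to the supply rate `s` and the everywhere defined
storage function `𝒮`. -/
def IsDissipative (N : SystemNode X U Y) (s : Y → U → ℝ) (𝒮 : X → ℝ) : Prop :=
  ∀ T : ℝ, 0 < T → ∀ (x : ℝ → X) (u : ℝ → U) (y : ℝ → Y),
    IsClassicalTrajectory N T x u y → DissipationInequality s 𝒮 T x u y

/-- The expression `2 Re ⟨P x, A&B (x, u)⟩ + s(C&D (x, u), u)` at `w = (x, u) ∈ dom A&B`. -/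
noncomputable def kypForm (N : SystemNode X U Y) (P : X →L[ℂ] X) (s : Y → U → ℝ)
    (w : N.AB.domain) : ℝ :=
  2 * (inner ℂ (P (w : X × U).1) (N.AB w)).re + s (N.CD w) (w : X × U).2

end Node

end SysNode

/-! The pointwise inequality `0 ≤ kypForm` is the derivative of the dissipation inequality. Along a
classical trajectory `𝒮 (x t) = Re ⟪P (x t), x t⟫` has derivative `2 Re ⟪P x, A&B (x, u)⟫`, so
integrating gives dissipativity (`IsClassicalTrajectory.dissipationInequality`).

Conversely, dividing by `T` and letting `T ↓ 0` recovers the pointwise inequality at any `w` where a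
trajectory starts (`IsDissipative.kypForm_nonneg`). One starts at every `w₀ = (x₀, u₀)`: with `z =
A&B w₀`, keep the input `u₀` and put `x t = x₀ + ∫₀ᵗ 𝔄 s z ds`. Since the main operator sends that
integral to `𝔄 t z - z`, one gets `A&B (x t, u₀) = 𝔄 t z = x' t`.

The rest is continuity and completion: `kypForm` is continuous in the graph norm, so a dense
subspace suffices; both sides of the dissipation inequality survive the limits that define
generalized trajectories; a nonnegative `kypForm` is the square of a seminorm on the domain, and
`KL` is the map into its completion. -/

namespace SysNode

/-! ### Factoring semidefinite forms -/

section Factorization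

/-- A positive semidefinite Hermitian form factors through a Hilbert space. -/
theorem exists_factorization {E : Type u} [AddCommGroup E] [Module ℂ E]
    (c : PreInnerProductSpace.Core ℂ E) :
    ∃ (Z : Type u) (_ : NormedAddCommGroup Z) (_ : InnerProductSpace ℂ Z)
      (_ : CompleteSpace Z) (K : E →ₗ[ℂ] Z),
      DenseRange K ∧ ∀ x : E, (c.inner x x).re = ‖K x‖ ^ 2 := by
  let _ : SeminormedAddCommGroup E := @InnerProductSpace.Core.toSeminormedAddCommGroup ℂ E _ _ _ c
  let _ : InnerProductSpace ℂ E := InnerProductSpace.ofCore c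
  -- The form may be degenerate; the completion is Hausdorff and so also divides out the null
  -- vectors.
  refine ⟨UniformSpace.Completion E, inferInstance, inferInstance, inferInstance,
    (UniformSpace.Completion.toComplₗᵢ (𝕜 := ℂ) (E := E)).toLinearMap, ?_, fun x => ?_⟩
  · exact UniformSpace.Completion.denseRange_coe
  · have h1 : ‖(UniformSpace.Completion.toComplₗᵢ (𝕜 := ℂ) (E := E)).toLinearMap x‖ = ‖x‖ :=
      UniformSpace.Completion.norm_coe x
    rw [h1, ← inner_self_eq_norm_sq (𝕜 := ℂ) x]
    rfl

end Factorization

/-! ### Graph norm estimates -/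

section GraphNorm

variable {E F G : Type*} [NormedAddCommGroup E] [NormedSpace ℂ E]
  [NormedAddCommGroup F] [NormedSpace ℂ F] [NormedAddCommGroup G] [NormedSpace ℂ G]

theorem graphNorm_nonneg (A : E × F →ₗ.[ℂ] G) (w : A.domain) : 0 ≤ graphNorm A w :=
  Real.sqrt_nonneg _

theorem norm_fst_le_graphNorm (A : E × F →ₗ.[ℂ] G) (w : A.domain) :
    ‖(w : E × F).1‖ ≤ graphNorm A w :=
  Real.le_sqrt_of_sq_le (by nlinarith [sq_nonneg ‖(w : E × F).2‖, sq_nonneg ‖A w‖])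

theorem norm_snd_le_graphNorm (A : E × F →ₗ.[ℂ] G) (w : A.domain) :
    ‖(w : E × F).2‖ ≤ graphNorm A w :=
  Real.le_sqrt_of_sq_le (by nlinarith [sq_nonneg ‖(w : E × F).1‖, sq_nonneg ‖A w‖])

theorem norm_apply_le_graphNorm (A : E × F →ₗ.[ℂ] G) (w : A.domain) :
    ‖A w‖ ≤ graphNorm A w :=
  Real.le_sqrt_of_sq_le (by nlinarith [sq_nonneg ‖(w : E × F).1‖, sq_nonneg ‖(w : E × F).2‖])

theorem IsBoundedOnDomain.exists_nonneg {H : Type*} [NormedAddCommGroup H] [NormedSpace ℂ H]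
    {A : E × F →ₗ.[ℂ] G} {K : A.domain →ₗ[ℂ] H} (hK : IsBoundedOnDomain A K) :
    ∃ c : ℝ, 0 ≤ c ∧ ∀ w : A.domain, ‖K w‖ ≤ c * graphNorm A w := by
  obtain ⟨c, hc⟩ := hK
  exact ⟨|c|, abs_nonneg c, fun w => (hc w).trans
    (mul_le_mul_of_nonneg_right (le_abs_self c) (graphNorm_nonneg A w))⟩

theorem tendsto_graphNorm_sub {ι : Type*} {l : Filter ι} {A : E × F →ₗ.[ℂ] G}
    {f : ι → A.domain} {w : A.domain}
    (h1 : Tendsto (fun i => (f i : E × F).1) l (𝓝 (w : E × F).1))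
    (h2 : Tendsto (fun i => (f i : E × F).2) l (𝓝 (w : E × F).2))
    (h3 : Tendsto (fun i => A (f i)) l (𝓝 (A w))) :
    Tendsto (fun i => graphNorm A (f i - w)) l (𝓝 0) := by
  have e1 := ((tendsto_iff_norm_sub_tendsto_zero.1 h1).pow 2).add
    ((tendsto_iff_norm_sub_tendsto_zero.1 h2).pow 2)
  have e2 := (e1.add ((tendsto_iff_norm_sub_tendsto_zero.1 h3).pow 2)).sqrt
  simpa [graphNorm, LinearPMap.map_sub] using e2

theorem IsBoundedOnDomain.tendsto {H : Type*} [NormedAddCommGroup H] [NormedSpace ℂ H]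
    {A : E × F →ₗ.[ℂ] G} {K : A.domain →ₗ[ℂ] H} (hK : IsBoundedOnDomain A K)
    {ι : Type*} {l : Filter ι} {f : ι → A.domain} {w : A.domain}
    (h : Tendsto (fun i => graphNorm A (f i - w)) l (𝓝 0)) :
    Tendsto (fun i => K (f i)) l (𝓝 (K w)) := by
  obtain ⟨c, hc⟩ := hK
  rw [tendsto_iff_norm_sub_tendsto_zero]
  refine squeeze_zero (fun _ => norm_nonneg _) (fun i => ?_) (by simpa using h.const_mul c)
  rw [← map_sub]
  exact hc _

end GraphNorm

/-! ### Integrated semigroup orbits -/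

section Semigroup

variable {E : Type*} [NormedAddCommGroup E] [NormedSpace ℂ E]

theorem C0Semigroup.continuous_orbit_toNNReal (𝔄 : C0Semigroup E) (z : E) :
    Continuous fun s : ℝ => 𝔄.toFun s.toNNReal z :=
  (𝔄.continuous_orbit z).comp continuous_real_toNNReal

theorem C0Semigroup.hasDerivAt_integral_orbit [CompleteSpace E] (𝔄 : C0Semigroup E) (z : E)
    (t : ℝ) :
    HasDerivAt (fun t : ℝ => ∫ s in (0 : ℝ)..t, 𝔄.toFun s.toNNReal z)
      (𝔄.toFun t.toNNReal z) t :=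
  intervalIntegral.integral_hasDerivAt_right
    ((𝔄.continuous_orbit_toNNReal z).intervalIntegrable _ _)
    ((𝔄.continuous_orbit_toNNReal z).stronglyMeasurableAtFilter _ _)
    (𝔄.continuous_orbit_toNNReal z).continuousAt

/-- `𝔄 h` passes under the integral and shifts the orbit by `h`, so both sides are the integral over
`[h, t + h]`. -/
theorem C0Semigroup.apply_integral_orbit [CompleteSpace E] (𝔄 : C0Semigroup E) (z : E)
    (h t : ℝ≥0) :
    𝔄.toFun h (∫ s in (0 : ℝ)..t, 𝔄.toFun s.toNNReal z) =
      (∫ s in (0 : ℝ)..(t + h : ℝ), 𝔄.toFun s.toNNReal z) -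
        ∫ s in (0 : ℝ)..(h : ℝ), 𝔄.toFun s.toNNReal z := by
  have hi (a b : ℝ) : IntervalIntegrable (fun s : ℝ => 𝔄.toFun s.toNNReal z) volume a b :=
    (𝔄.continuous_orbit_toNNReal z).intervalIntegrable _ _
  rw [intervalIntegral.integral_interval_sub_left (hi _ _) (hi _ _),
    ← ContinuousLinearMap.intervalIntegral_comp_comm _ (hi _ _)]
  have := intervalIntegral.integral_comp_add_right (a := 0) (b := t)
    (fun s : ℝ => 𝔄.toFun s.toNNReal z) (h : ℝ)
  rw [zero_add] at this
  rw [← this]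
  refine intervalIntegral.integral_congr fun s hs => ?_
  rw [Set.uIcc_of_le (NNReal.coe_nonneg t)] at hs
  have e : (s + h).toNNReal = h + s.toNNReal := by
    rw [Real.toNNReal_add hs.1 (NNReal.coe_nonneg h), Real.toNNReal_coe, add_comm]
  simp [e, 𝔄.map_add]

/-- By `apply_integral_orbit`, the difference quotient of the semigroup at the integral is the slope
of the integral at `t` minus its slope at `0`; these tend to `𝔄 t z` and `z`. -/
theorem C0Semigroup.IsGeneratedBy.integral_orbit_mem_graph [CompleteSpace E]
    {𝔄 : C0Semigroup E} {A : E →ₗ.[ℂ] E} (hA : 𝔄.IsGeneratedBy A) (z : E) (t : ℝ≥0) :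
    (∫ s in (0 : ℝ)..t, 𝔄.toFun s.toNNReal z, 𝔄.toFun t z - z) ∈ A.graph := by
  rw [hA]
  have hco : Tendsto (fun h : ℝ≥0 => (h : ℝ)) (𝓝[>] 0) (𝓝[≠] 0) := by
    refine tendsto_nhdsWithin_iff.2 ⟨?_, ?_⟩
    · exact (NNReal.continuous_coe.tendsto' 0 0 rfl).mono_left nhdsWithin_le_nhds
    · filter_upwards [self_mem_nhdsWithin] with h hh
      exact ne_of_gt (NNReal.coe_pos.2 hh)
  have d1 := ((hasDerivAt_iff_tendsto_slope_zero.1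
    (𝔄.hasDerivAt_integral_orbit z t)).comp hco)
  have d0 := ((hasDerivAt_iff_tendsto_slope_zero.1
    (𝔄.hasDerivAt_integral_orbit z 0)).comp hco)
  have e := d1.sub d0
  simp only [Real.toNNReal_coe, Real.toNNReal_zero, 𝔄.map_zero, ContinuousLinearMap.id_apply,
    Function.comp_def, zero_add, intervalIntegral.integral_same, sub_zero] at e
  refine e.congr fun h => ?_
  rw [𝔄.apply_integral_orbit, ← smul_sub]
  congr 1
  abel

end Semigroup

/-! ### The storage function along curves -/

section Storage

variable {X : Type*} [NormedAddCommGroup X] [InnerProductSpace ℂ X] [CompleteSpace X]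

/-- Polarizing at the pair `(x/2, x/2)` leaves `(𝒮 x - 𝒮 0) / 4` as real part, and boundedness
forces `𝒮 0 = 0`; homogeneity of `𝒮` is not needed. -/
theorem IsInducedOperator.eq_re_inner {𝒮 : X → ℝ} {P : X →L[ℂ] X} (hP : IsInducedOperator 𝒮 P)
    (hb : IsBoundedForm 𝒮) (x : X) : 𝒮 x = (inner ℂ (P x) x).re := by
  obtain ⟨c, -, hc⟩ := hb
  have h0 : 𝒮 0 = 0 := by simpa using hc 0
  have h := congrArg Complex.re (hP.form_eq ((1 / 2 : ℝ) • x) ((1 / 2 : ℝ) • x))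
  have e : (1 / 2 : ℝ) • x + (1 / 2 : ℝ) • x = x := by rw [← add_smul]; norm_num
  have hz : P ((1 / 2 : ℝ) • x) = (1 / 2 : ℝ) • P x :=
    (P.restrictScalars ℝ).map_smul _ _
  rw [polarForm, e, sub_self, h0, hz, inner_smul_left_eq_smul, inner_smul_right_eq_smul] at h
  have e4 : (1 / 4 : ℂ) = ((1 / 4 : ℝ) : ℂ) := by norm_num
  rw [e4, Complex.re_ofReal_mul] at h
  simp at h
  linarith

theorem re_inner_apply_comm {P : X →L[ℂ] X} (hP : IsSelfAdjoint P) (a b : X) :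
    (inner ℂ (P a) b).re = (inner ℂ (P b) a).re := by
  rw [show inner ℂ (P a) b = inner ℂ a (P b) from hP.isSymmetric a b]
  exact inner_re_symm (𝕜 := ℂ) a (P b)

theorem hasDerivWithinAt_re_inner_apply {P : X →L[ℂ] X} (hP : IsSelfAdjoint P)
    {x : ℝ → X} {x' : X} {s : Set ℝ} {t : ℝ} (hx : HasDerivWithinAt x x' s t) :
    HasDerivWithinAt (fun t => (inner ℂ (P (x t)) (x t)).re)
      (2 * (inner ℂ (P (x t)) x').re) s t := by
  have hPx : HasDerivWithinAt (fun t => P (x t)) (P x') s t :=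
    (P.restrictScalars ℝ).hasFDerivAt.comp_hasDerivWithinAt t hx
  have h := Complex.reCLM.hasFDerivAt.comp_hasDerivWithinAt t (hPx.inner ℂ hx)
  refine h.congr_deriv ?_
  simp only [Complex.reCLM_apply, Complex.add_re]
  rw [re_inner_apply_comm hP x' (x t), two_mul]

end Storage

/-! ### Sesquilinear pairings in `L²` -/

section SquareIntegrable

variable {α : Type*} [MeasurableSpace α] {μ : Measure α}
  {E F : Type*} [NormedAddCommGroup E] [InnerProductSpace ℂ E]
  [NormedAddCommGroup F] [InnerProductSpace ℂ F]

theorem inner_toLp_compLpL (L : F →L[ℂ] E) {f : α → E} {g : α → F}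
    (hf : MemLp f 2 μ) (hg : MemLp g 2 μ) :
    inner ℂ (hf.toLp f) (L.compLpL 2 μ (hg.toLp g)) = ∫ a, inner ℂ (f a) (L (g a)) ∂μ := by
  rw [L2.inner_def]
  refine integral_congr_ae ?_
  filter_upwards [hf.coeFn_toLp, hg.coeFn_toLp, L.coeFn_compLpL (hg.toLp g)] with a h1 h2 h3
  rw [h1, h3, h2]

theorem integrable_inner_apply (L : F →L[ℂ] E) {f : α → E} {g : α → F}
    (hf : MemLp f 2 μ) (hg : MemLp g 2 μ) :
    Integrable (fun a => inner ℂ (f a) (L (g a))) μ := by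
  refine (L2.integrable_inner (𝕜 := ℂ) (hf.toLp f) (L.compLpL 2 μ (hg.toLp g))).congr ?_
  filter_upwards [hf.coeFn_toLp, hg.coeFn_toLp, L.coeFn_compLpL (hg.toLp g)] with a h1 h2 h3
  rw [h1, h3, h2]

theorem tendsto_integral_inner_apply (L : F →L[ℂ] E) {f : α → E} {g : α → F}
    {fs : ℕ → α → E} {gs : ℕ → α → F}
    (hf : MemLp f 2 μ) (hg : MemLp g 2 μ) (hfs : ∀ n, MemLp (fs n) 2 μ)
    (hgs : ∀ n, MemLp (gs n) 2 μ)
    (hfl : Tendsto (fun n => eLpNorm (fs n - f) 2 μ) atTop (𝓝 0))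
    (hgl : Tendsto (fun n => eLpNorm (gs n - g) 2 μ) atTop (𝓝 0)) :
    Tendsto (fun n => ∫ a, inner ℂ (fs n a) (L (gs n a)) ∂μ) atTop
      (𝓝 (∫ a, inner ℂ (f a) (L (g a)) ∂μ)) := by
  have h1 := (Lp.tendsto_Lp_iff_tendsto_eLpNorm'' fs hfs f hf).2 hfl
  have h2 := (Lp.tendsto_Lp_iff_tendsto_eLpNorm'' gs hgs g hg).2 hgl
  have h3 := h1.inner (𝕜 := ℂ) (((L.compLpL 2 μ).continuous.tendsto _).comp h2)
  simp only [Function.comp_def, inner_toLp_compLpL] at h3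
  exact h3

theorem memLp_of_continuousOn_Icc {E : Type*} [NormedAddCommGroup E] {f : ℝ → E} {a b : ℝ} {p : ℝ≥0∞}
    (hf : ContinuousOn f (Set.Icc a b)) : MemLp f p (volume.restrict (Set.Icc a b)) := by
  obtain ⟨C, hC⟩ := isCompact_Icc.exists_bound_of_continuousOn hf
  exact MemLp.of_bound (hf.aestronglyMeasurable_of_isCompact isCompact_Icc measurableSet_Icc) C
    (ae_restrict_of_forall_mem measurableSet_Icc hC)

end SquareIntegrable

/-! ### The supply rate and its integral -/

section SupplyRate

variable {U : Type v} {Y : Type w}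
  [NormedAddCommGroup U] [InnerProductSpace ℂ U] [CompleteSpace U]
  [NormedAddCommGroup Y] [InnerProductSpace ℂ Y] [CompleteSpace Y]
  (Q : Y →L[ℂ] Y) (S : U →L[ℂ] Y) (R : U →L[ℂ] U)

theorem supplyRate_eq (y : Y) (u : U) :
    supplyRate Q S R y u = (inner ℂ y (Q y) + inner ℂ y (S u) +
      (inner ℂ u (ContinuousLinearMap.adjoint S y) + inner ℂ u (R u))).re := by
  simp only [supplyRate, WithLp.prod_inner_apply, inner_add_right]

theorem continuous_supplyRate : Continuous fun p : Y × U => supplyRate Q S R p.1 p.2 := by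
  simp only [supplyRate_eq]
  fun_prop

/-- Splitting into four `L²` pairings allows passing to the limit term by term. -/
theorem integral_supplyRate {α : Type*} [MeasurableSpace α] {μ : Measure α} {y : α → Y}
    {u : α → U} (hy : MemLp y 2 μ) (hu : MemLp u 2 μ) :
    ∫ t, supplyRate Q S R (y t) (u t) ∂μ =
      ((∫ t, inner ℂ (y t) (Q (y t)) ∂μ) + (∫ t, inner ℂ (y t) (S (u t)) ∂μ) +
      ((∫ t, inner ℂ (u t) (ContinuousLinearMap.adjoint S (y t)) ∂μ) +
        ∫ t, inner ℂ (u t) (R (u t)) ∂μ)).re := by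
  have i1 := integrable_inner_apply Q hy hy
  have i2 := integrable_inner_apply S hy hu
  have i3 := integrable_inner_apply (ContinuousLinearMap.adjoint S) hu hy
  have i4 := integrable_inner_apply R hu hu
  have e := integral_add (i1.add i2) (i3.add i4)
  simp only [Pi.add_apply] at e
  rw [← integral_add i1 i2, ← integral_add i3 i4, ← e]
  simp only [supplyRate_eq]
  exact integral_re ((i1.add i2).add (i3.add i4))

theorem tendsto_integral_supplyRate {α : Type*} [MeasurableSpace α] {μ : Measure α} {y : α → Y}
    {u : α → U} {ys : ℕ → α → Y} {us : ℕ → α → U} (hy : MemLp y 2 μ) (hu : MemLp u 2 μ)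
    (hys : ∀ n, MemLp (ys n) 2 μ) (hus : ∀ n, MemLp (us n) 2 μ)
    (hyl : Tendsto (fun n => eLpNorm (ys n - y) 2 μ) atTop (𝓝 0))
    (hul : Tendsto (fun n => eLpNorm (us n - u) 2 μ) atTop (𝓝 0)) :
    Tendsto (fun n => ∫ t, supplyRate Q S R (ys n t) (us n t) ∂μ) atTop
      (𝓝 (∫ t, supplyRate Q S R (y t) (u t) ∂μ)) := by
  simp only [integral_supplyRate Q S R hy hu, fun n => integral_supplyRate Q S R (hys n) (hus n)]
  exact (Complex.continuous_re.tendsto _).comp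
    (((tendsto_integral_inner_apply Q hy hy hys hys hyl hyl).add
      (tendsto_integral_inner_apply S hy hu hys hus hyl hul)).add
    ((tendsto_integral_inner_apply _ hu hy hus hys hul hyl).add
      (tendsto_integral_inner_apply R hu hu hus hus hul hul)))

end SupplyRate

/-! ### Trajectories and dissipation -/

section Node

variable {X : Type u} {U : Type v} {Y : Type w}
  [NormedAddCommGroup X] [InnerProductSpace ℂ X]
  [NormedAddCommGroup U] [InnerProductSpace ℂ U]
  [NormedAddCommGroup Y] [InnerProductSpace ℂ Y]

theorem tendsto_kypForm (N : SystemNode X U Y) (P : X →L[ℂ] X) {s : Y → U → ℝ}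
    (hs : Continuous fun p : Y × U => s p.1 p.2) {ι : Type*} {l : Filter ι}
    {f : ι → N.AB.domain} {w : N.AB.domain}
    (h : Tendsto (fun i => graphNorm N.AB (f i - w)) l (𝓝 0)) :
    Tendsto (fun i => kypForm N P s (f i)) l (𝓝 (kypForm N P s w)) := by
  have h1 : Tendsto (fun i => (f i : X × U).1) l (𝓝 (w : X × U).1) :=
    tendsto_iff_norm_sub_tendsto_zero.2
      (squeeze_zero (fun _ => norm_nonneg _) (fun i => norm_fst_le_graphNorm N.AB (f i - w)) h)
  have h2 : Tendsto (fun i => (f i : X × U).2) l (𝓝 (w : X × U).2) :=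
    tendsto_iff_norm_sub_tendsto_zero.2
      (squeeze_zero (fun _ => norm_nonneg _) (fun i => norm_snd_le_graphNorm N.AB (f i - w)) h)
  have h3 : Tendsto (fun i => N.AB (f i)) l (𝓝 (N.AB w)) := by
    refine tendsto_iff_norm_sub_tendsto_zero.2
      (squeeze_zero (fun _ => norm_nonneg _) (fun i => ?_) h)
    rw [← LinearPMap.map_sub]
    exact norm_apply_le_graphNorm N.AB (f i - w)
  have h4 := N.bounded_CD.tendsto h
  have h5 : Tendsto (fun i => s (N.CD (f i)) (f i : X × U).2) l
      (𝓝 (s (N.CD w) (w : X × U).2)) := (hs.tendsto (N.CD w, (w : X × U).2)).comp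
        (h4.prodMk_nhds h2)
  have h6 := ((P.continuous.tendsto _).comp h1).inner (𝕜 := ℂ) h3
  exact (((Complex.continuous_re.tendsto _).comp h6).const_mul 2).add h5

theorem kypForm_nonneg_of_dense (N : SystemNode X U Y) (P : X →L[ℂ] X) {s : Y → U → ℝ}
    (hs : Continuous fun p : Y × U => s p.1 p.2) {W : Submodule ℂ N.AB.domain}
    (hW : IsDenseInDomain N.AB W) (h : ∀ w ∈ W, 0 ≤ kypForm N P s w) (w : N.AB.domain) :
    0 ≤ kypForm N P s w := by
  choose f hf hfw using fun n : ℕ => hW w (1 / (n + 1)) Nat.one_div_pos_of_nat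
  have hlim : Tendsto (fun n => graphNorm N.AB (f n - w)) atTop (𝓝 0) := by
    refine squeeze_zero (fun n => graphNorm_nonneg _ _) (fun n => ?_)
      tendsto_one_div_add_atTop_nhds_zero_nat
    refine le_of_eq_of_le ?_ (hfw n).le
    simp only [graphNorm, LinearPMap.map_sub, Submodule.coe_sub, Prod.fst_sub, Prod.snd_sub,
      norm_sub_rev]
  exact ge_of_tendsto' (tendsto_kypForm N P hs hlim) fun n => h _ (hf n)

/-- Every point of the domain is the value at time zero of a classical trajectory with constant
input. -/
theorem SystemNode.exists_classicalTrajectory [CompleteSpace X] (N : SystemNode X U Y)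
    (w₀ : N.AB.domain) :
    ∃ (x : ℝ → X) (y : ℝ → Y), x 0 = (w₀ : X × U).1 ∧ y 0 = N.CD w₀ ∧ Continuous y ∧
      HasDerivAt x (N.AB w₀) 0 ∧
      ∀ T : ℝ, 0 < T → IsClassicalTrajectory N T x (fun _ => (w₀ : X × U).2) y := by
  obtain ⟨𝔄, hA⟩ := N.exists_semigroup
  set z := N.AB w₀ with hz
  -- For `s < 0` the integrand is the constant `z`, so `v` continues linearly to negative times and
  -- is differentiable on both sides of `0`.
  set v : ℝ → X := fun t => ∫ s in (0 : ℝ)..t, 𝔄.toFun s.toNNReal z with hv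
  have hd (t : ℝ) : HasDerivAt v (𝔄.toFun t.toNNReal z) t := 𝔄.hasDerivAt_integral_orbit z t
  have hvc : Continuous v := continuous_iff_continuousAt.2 fun t => (hd t).continuousAt
  have hg (t : ℝ≥0) : ∃ a : N.AB.domain, (a : X × U) = (v t, 0) ∧
      N.AB a = 𝔄.toFun t z - z := by
    obtain ⟨a, ha1, ha2⟩ := (LinearPMap.mem_graph_iff _).1 (hA.integral_orbit_mem_graph z t)
    refine ⟨⟨(a, 0), a.2⟩, ?_, ha2⟩
    exact Prod.ext ha1 rfl
  choose a ha1 ha2 using hg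
  -- The `-z` from the main operator cancels `A&B w₀ = z`; this is the differential equation.
  have hAB (t : ℝ≥0) : N.AB (w₀ + a t) = 𝔄.toFun t z := by
    rw [LinearPMap.map_add, ha2, ← hz, add_sub_cancel]
  have hco (t : ℝ≥0) : ((w₀ + a t : N.AB.domain) : X × U) =
      ((w₀ : X × U).1 + v t, (w₀ : X × U).2) := by
    rw [Submodule.coe_add, ha1]
    ext <;> simp
  have ha0 : a 0 = 0 := by
    ext <;> simp [ha1, hv]
  have hy : Continuous fun t : ℝ => N.CD (w₀ + a t.toNNReal) := by
    refine continuous_iff_continuousAt.2 fun t => ?_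
    refine N.bounded_CD.tendsto (tendsto_graphNorm_sub ?_ ?_ ?_)
    · simp only [hco]
      exact Continuous.tendsto (continuous_const.add (hvc.comp
        (NNReal.continuous_coe.comp continuous_real_toNNReal))) t
    · simp only [hco]
      exact tendsto_const_nhds
    · simp only [hAB]
      exact (𝔄.continuous_orbit_toNNReal z).tendsto t
  have hx (t : ℝ) : HasDerivAt (fun t => (w₀ : X × U).1 + v t) (𝔄.toFun t.toNNReal z) t :=
    (hd t).const_add _
  refine ⟨fun t => (w₀ : X × U).1 + v t, fun t => N.CD (w₀ + a t.toNNReal), ?_, ?_, hy, ?_,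
    fun T _ => ⟨?_, continuousOn_const, hy.continuousOn, fun t ht => ?_⟩⟩
  · simp [hv]
  · simp [ha0]
  · simpa [𝔄.map_zero] using hx 0
  · refine (contDiff_one_iff_deriv.2 ⟨fun t => (hx t).differentiableAt, ?_⟩).contDiffOn
    rw [show deriv (fun t => (w₀ : X × U).1 + v t) = fun t : ℝ => 𝔄.toFun t.toNNReal z from
      funext fun t => (hx t).deriv]
    exact 𝔄.continuous_orbit_toNNReal z
  · have e := hco t.toNNReal
    rw [Real.coe_toNNReal t ht.1] at e
    have hm : ((w₀ : X × U).1 + v t, (w₀ : X × U).2) ∈ N.AB.domain := e ▸ (w₀ + a t.toNNReal).2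
    have e' : (⟨((w₀ : X × U).1 + v t, (w₀ : X × U).2), hm⟩ : N.AB.domain) =
        w₀ + a t.toNNReal := Subtype.ext e.symm
    refine ⟨hm, ?_, ?_⟩
    · rw [e', hAB]
      exact (hx t).hasDerivWithinAt
    · rw [e']

theorem IsClassicalTrajectory.isGeneralizedTrajectory {N : SystemNode X U Y} {T : ℝ} {x : ℝ → X}
    {u : ℝ → U} {y : ℝ → Y} (hc : IsClassicalTrajectory N T x u y) :
    IsGeneralizedTrajectory N T x u y where
  continuousOn_x := hc.contDiffOn_x.continuousOn
  memLp_u := memLp_of_continuousOn_Icc hc.continuousOn_u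
  memLp_y := memLp_of_continuousOn_Icc hc.continuousOn_y
  exists_approx := ⟨fun _ => x, fun _ => u, fun _ => y, fun _ => hc,
    fun _ hv => Eventually.of_forall fun _ _ _ => refl_mem_uniformity hv, by simp, by simp⟩

/-- Uniform convergence handles the endpoint terms, `L²` convergence the supply integral. -/
theorem IsDissipative.dissipationInequality_of_isGeneralizedTrajectory
    [CompleteSpace U] [CompleteSpace Y] {Q : Y →L[ℂ] Y} {S : U →L[ℂ] Y} {R : U →L[ℂ] U}
    {N : SystemNode X U Y}
    {𝒮 : X → ℝ} (h𝒮 : Continuous 𝒮) (h : IsDissipative N (supplyRate Q S R) 𝒮)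
    {T : ℝ} (hT : 0 < T) {x : ℝ → X} {u : ℝ → U} {y : ℝ → Y}
    (hg : IsGeneralizedTrajectory N T x u y) :
    DissipationInequality (supplyRate Q S R) 𝒮 T x u y := by
  obtain ⟨xs, us, ys, hc, hxl, hul, hyl⟩ := hg.exists_approx
  have hlim := tendsto_integral_supplyRate Q S R hg.memLp_y hg.memLp_u
    (fun n => memLp_of_continuousOn_Icc (hc n).continuousOn_y)
    (fun n => memLp_of_continuousOn_Icc (hc n).continuousOn_u) hyl hul
  have hxT := (h𝒮.tendsto _).comp (hxl.tendsto_at (Set.right_mem_Icc.2 hT.le))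
  have hx0 := (h𝒮.tendsto _).comp (hxl.tendsto_at (Set.left_mem_Icc.2 hT.le))
  rw [DissipationInequality, intervalIntegral.integral_of_le hT.le, ← integral_Icc_eq_integral_Ioc]
  refine ge_of_tendsto' ((hxT.sub hx0).add hlim) fun n => ?_
  have := h T hT _ _ _ (hc n)
  rwa [DissipationInequality, intervalIntegral.integral_of_le hT.le,
    ← integral_Icc_eq_integral_Ioc] at this

section Classical

variable [CompleteSpace X]

theorem IsClassicalTrajectory.dissipationInequality {N : SystemNode X U Y} {P : X →L[ℂ] X}
    {s : Y → U → ℝ} {𝒮 : X → ℝ} (hs : Continuous fun p : Y × U => s p.1 p.2)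
    (hP : IsSelfAdjoint P) (h𝒮 : ∀ x, 𝒮 x = (inner ℂ (P x) x).re)
    (h : ∀ w, 0 ≤ kypForm N P s w) {T : ℝ} (hT : 0 < T) {x : ℝ → X} {u : ℝ → U} {y : ℝ → Y}
    (hc : IsClassicalTrajectory N T x u y) : DissipationInequality s 𝒮 T x u y := by
  choose! hm hd hy using hc.equation
  have hder (t : ℝ) (ht : t ∈ Set.Icc 0 T) := hasDerivWithinAt_re_inner_apply hP (hd t ht)
  -- This form of the fundamental theorem asks for integrability of the supply rate only, not of the
  -- derivative. `derivWithin` makes `g'` a total function, whereas `A&B` needs a membership proof.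
  have key := intervalIntegral.sub_le_integral_of_hasDeriv_right_of_le hT.le
    (g := fun t => -(inner ℂ (P (x t)) (x t)).re)
    (g' := fun t => -derivWithin (fun t => (inner ℂ (P (x t)) (x t)).re) (Set.Icc 0 T) t)
    (φ := fun t => s (y t) (u t))
    (fun t ht => (hder t ht).neg.continuousWithinAt) (fun t ht => ?_) ?_ (fun t ht => ?_)
  · rw [DissipationInequality, h𝒮, h𝒮]
    linarith
  · have ht' := Set.Ioo_subset_Icc_self ht
    have hn := (hder t ht').hasDerivAt (Icc_mem_nhds ht.1 ht.2)
    rw [(hder t ht').derivWithin (uniqueDiffOn_Icc hT t ht')]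
    exact hn.neg.hasDerivWithinAt
  · exact (hs.comp_continuousOn (hc.continuousOn_y.prodMk hc.continuousOn_u)).integrableOn_Icc
  · have ht' := Set.Ioo_subset_Icc_self ht
    rw [(hder t ht').derivWithin (uniqueDiffOn_Icc hT t ht'), hy t ht']
    have := h ⟨_, hm t ht'⟩
    rw [kypForm] at this
    linarith

theorem IsDissipative.kypForm_nonneg {N : SystemNode X U Y} {P : X →L[ℂ] X}
    {s : Y → U → ℝ} {𝒮 : X → ℝ} (hs : Continuous fun p : Y × U => s p.1 p.2)
    (hP : IsSelfAdjoint P) (h𝒮 : ∀ x, 𝒮 x = (inner ℂ (P x) x).re)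
    (h : IsDissipative N s 𝒮) (w : N.AB.domain) : 0 ≤ kypForm N P s w := by
  obtain ⟨x, y, hx0, hy0, hyc, hxd, htr⟩ := N.exists_classicalTrajectory w
  have hsc : Continuous fun t => s (y t) (w : X × U).2 := hs.comp (hyc.prodMk continuous_const)
  have h1 : HasDerivAt (fun t => (inner ℂ (P (x t)) (x t)).re)
      (2 * (inner ℂ (P (x 0)) (N.AB w)).re) 0 := by
    rw [← hasDerivWithinAt_univ] at hxd ⊢
    exact hasDerivWithinAt_re_inner_apply hP hxd
  have h2 : HasDerivAt (fun T => ∫ t in (0 : ℝ)..T, s (y t) (w : X × U).2)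
      (s (y 0) (w : X × U).2) 0 :=
    intervalIntegral.integral_hasDerivAt_right (hsc.intervalIntegrable _ _)
      (hsc.stronglyMeasurableAtFilter _ _) hsc.continuousAt
  -- Only the right-hand limit is usable, as dissipativity speaks of `T > 0`.
  have h3 := (hasDerivAt_iff_tendsto_slope_zero.1 (h1.add h2)).mono_left
    (nhdsWithin_mono 0 fun t (ht : t ∈ Set.Ioi (0 : ℝ)) => ne_of_gt ht)
  rw [hx0, hy0] at h3
  refine ge_of_tendsto h3 ?_
  filter_upwards [self_mem_nhdsWithin] with T hT
  have h4 := h T hT x _ y (htr T hT)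
  rw [DissipationInequality, h𝒮, h𝒮] at h4
  refine smul_nonneg (inv_nonneg.2 (le_of_lt hT)) ?_
  simp only [Pi.add_apply, zero_add, intervalIntegral.integral_same, add_zero]
  linarith

end Classical

/-! ### Factorization of `kypForm` -/

variable [CompleteSpace U] [CompleteSpace Y]
  {Q : Y →L[ℂ] Y} {S : U →L[ℂ] Y} {R : U →L[ℂ] U}

/-- The Hermitian form on the domain of a system node whose quadratic form is `kypForm`. -/
noncomputable def kypInner (N : SystemNode X U Y) (P : X →L[ℂ] X) (Q : Y →L[ℂ] Y) (S : U →L[ℂ] Y)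
    (R : U →L[ℂ] U) (w w' : N.AB.domain) : ℂ :=
  inner ℂ (P (w : X × U).1) (N.AB w') + inner ℂ (N.AB w) (P (w' : X × U).1) +
    (inner ℂ (N.CD w) (Q (N.CD w')) + inner ℂ (N.CD w) (S (w' : X × U).2) +
      (inner ℂ (S (w : X × U).2) (N.CD w') + inner ℂ (w : X × U).2 (R (w' : X × U).2)))

/-- On the diagonal the two terms with `P` are conjugate, which accounts for the factor `2`. -/
theorem re_kypInner_self (N : SystemNode X U Y) (P : X →L[ℂ] X) (Q : Y →L[ℂ] Y) (S : U →L[ℂ] Y)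
    (R : U →L[ℂ] U) (w : N.AB.domain) :
    (kypInner N P Q S R w w).re = kypForm N P (supplyRate Q S R) w := by
  have e := inner_re_symm (𝕜 := ℂ) (N.AB w) (P (w : X × U).1)
  simp only [kypInner, kypForm, supplyRate_eq, RCLike.re_eq_complex_re, Complex.add_re,
    ContinuousLinearMap.adjoint_inner_right] at *
  linarith

/-- A nonnegative `kypForm` turns the domain of a system node into a semi-inner product space. -/
noncomputable abbrev kypCore (N : SystemNode X U Y) {P : X →L[ℂ] X} (hQ : IsSelfAdjoint Q)
    (hR : IsSelfAdjoint R) (h : ∀ w, 0 ≤ kypForm N P (supplyRate Q S R) w) :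
    PreInnerProductSpace.Core ℂ N.AB.domain where
  inner := kypInner N P Q S R
  conj_inner_symm w w' := by
    have h1 : inner ℂ (Q (N.CD w)) (N.CD w') = inner ℂ (N.CD w) (Q (N.CD w')) :=
      hQ.isSymmetric _ _
    have h2 : inner ℂ (R (w : X × U).2) (w' : X × U).2 =
      inner ℂ (w : X × U).2 (R (w' : X × U).2) := hR.isSymmetric _ _
    simp only [kypInner, map_add, inner_conj_symm, h1, h2]
    ring
  re_inner_nonneg w := (h w).trans_eq (re_kypInner_self N P Q S R w).symm
  add_left w₁ w₂ w' := by
    simp only [kypInner, LinearPMap.map_add, Submodule.coe_add, Prod.fst_add, Prod.snd_add,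
      map_add, inner_add_left]
    ring
  smul_left w w' r := by
    simp only [kypInner, LinearPMap.map_smul, Submodule.coe_smul, Prod.smul_fst, Prod.smul_snd,
      map_smul, inner_smul_left]
    ring

theorem re_inner_apply_le {E F : Type*} [NormedAddCommGroup E] [InnerProductSpace ℂ E]
    [NormedAddCommGroup F] [InnerProductSpace ℂ F] (L : F →L[ℂ] E) {e : E} {f : F} {α β : ℝ}
    (he : ‖e‖ ≤ α) (hf : ‖f‖ ≤ β) : (inner ℂ e (L f)).re ≤ ‖L‖ * (α * β) := by
  have hα : 0 ≤ α := (norm_nonneg e).trans he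
  calc (inner ℂ e (L f)).re ≤ ‖e‖ * ‖L f‖ := re_inner_le_norm (𝕜 := ℂ) e (L f)
    _ ≤ α * (‖L‖ * β) := by gcongr; exact L.le_opNorm_of_le hf
    _ = ‖L‖ * (α * β) := by ring

theorem exists_kypForm_le (N : SystemNode X U Y) (P : X →L[ℂ] X) (Q : Y →L[ℂ] Y) (S : U →L[ℂ] Y)
    (R : U →L[ℂ] U) : ∃ C : ℝ, 0 ≤ C ∧ ∀ w : N.AB.domain,
      kypForm N P (supplyRate Q S R) w ≤ C * graphNorm N.AB w ^ 2 := by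
  obtain ⟨c, hc0, hc⟩ := N.bounded_CD.exists_nonneg
  -- One operator norm per term of the form, with a factor `c` for each occurrence of `C&D w`.
  refine ⟨2 * ‖P‖ + (‖Q‖ * (c * c) + ‖S‖ * c + (‖S‖ * c + ‖R‖)), by positivity, fun w => ?_⟩
  have h2 := norm_snd_le_graphNorm N.AB w
  have k1 := re_inner_apply_le P (norm_apply_le_graphNorm N.AB w) (norm_fst_le_graphNorm N.AB w)
  have k2 := re_inner_apply_le Q (hc w) (hc w)
  have k3 := re_inner_apply_le S (hc w) h2
  have k4 := re_inner_apply_le R h2 h2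
  have e1 := inner_re_symm (𝕜 := ℂ) (N.AB w) (P (w : X × U).1)
  have e2 := inner_re_symm (𝕜 := ℂ) (N.CD w) (S (w : X × U).2)
  rw [kypForm, supplyRate_eq]
  simp only [RCLike.re_eq_complex_re, Complex.add_re,
    ContinuousLinearMap.adjoint_inner_right] at *
  linarith

theorem exists_kypForm_factorization (N : SystemNode X U Y) {P : X →L[ℂ] X}
    (hQ : IsSelfAdjoint Q) (hR : IsSelfAdjoint R)
    (h : ∀ w, 0 ≤ kypForm N P (supplyRate Q S R) w) :
    ∃ (Z : Type (max u v)) (_ : NormedAddCommGroup Z) (_ : InnerProductSpace ℂ Z)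
      (_ : CompleteSpace Z) (KL : N.AB.domain →ₗ[ℂ] Z),
      IsBoundedOnDomain N.AB KL ∧ DenseRange KL ∧
      ∀ w : N.AB.domain, kypForm N P (supplyRate Q S R) w = ‖KL w‖ ^ 2 := by
  obtain ⟨Z, i1, i2, i3, K, hK, hKn⟩ := exists_factorization (kypCore N hQ hR h)
  have hKn' (w : N.AB.domain) : kypForm N P (supplyRate Q S R) w = ‖K w‖ ^ 2 := by
    rw [← re_kypInner_self]
    exact hKn w
  obtain ⟨C, hC0, hC⟩ := exists_kypForm_le N P Q S R
  -- `‖K w‖ ^ 2` is the form itself, so its quadratic bound `C` gives the operator bound `√C`.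
  refine ⟨Z, i1, i2, i3, K, ⟨√C, fun w => ?_⟩, hK, hKn'⟩
  refine abs_le_of_sq_le_sq' ?_ (by have := graphNorm_nonneg N.AB w; positivity) |>.2
  rw [mul_pow, Real.sq_sqrt hC0, ← hKn']
  exact hC w

end Node

end SysNode

/-! ### The equivalences -/

theorem theorem4p1
    {X : Type u} {U : Type v} {Y : Type w}
    [NormedAddCommGroup X] [InnerProductSpace ℂ X] [CompleteSpace X]
    [NormedAddCommGroup U] [InnerProductSpace ℂ U] [CompleteSpace U]
    [NormedAddCommGroup Y] [InnerProductSpace ℂ Y] [CompleteSpace Y]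
    (N : SysNode.SystemNode X U Y)
    (Q : Y →L[ℂ] Y) (S : U →L[ℂ] Y) (R : U →L[ℂ] U)
    (hQ : IsSelfAdjoint Q) (hR : IsSelfAdjoint R)
    (𝒮 : X → ℝ) (hquad : SysNode.IsRealQuadraticForm 𝒮) (hbdd : SysNode.IsBoundedForm 𝒮)
    (P : X →L[ℂ] X) (hP : SysNode.IsInducedOperator 𝒮 P) :
    List.TFAE [
      -- dissipativity
      SysNode.IsDissipative N (SysNode.supplyRate Q S R) 𝒮,
      -- the inequality on a subspace that is dense in the graph norm
      ∃ W : Submodule ℂ N.AB.domain, SysNode.IsDenseInDomain N.AB W ∧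
        ∀ w ∈ W, 0 ≤ SysNode.kypForm N P (SysNode.supplyRate Q S R) w,
      -- the inequality on the whole domain
      ∀ w : N.AB.domain, 0 ≤ SysNode.kypForm N P (SysNode.supplyRate Q S R) w,
      -- the factorization
      ∃ (Z : Type (max u v)) (_ : NormedAddCommGroup Z) (_ : InnerProductSpace ℂ Z)
        (_ : CompleteSpace Z) (KL : N.AB.domain →ₗ[ℂ] Z),
        SysNode.IsBoundedOnDomain N.AB KL ∧ DenseRange KL ∧
        ∀ w : N.AB.domain,
          SysNode.kypForm N P (SysNode.supplyRate Q S R) w = ‖KL w‖ ^ 2,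
      -- the dissipation inequality along all generalized trajectories
      ∀ T : ℝ, 0 < T → ∀ (x : ℝ → X) (u : ℝ → U) (y : ℝ → Y),
        SysNode.IsGeneralizedTrajectory N T x u y →
        SysNode.DissipationInequality (SysNode.supplyRate Q S R) 𝒮 T x u y] := by
  have h𝒮 := hP.eq_re_inner hbdd
  have hs := SysNode.continuous_supplyRate Q S R
  have hcont : Continuous 𝒮 := by
    rw [funext h𝒮]
    fun_prop
  tfae_have 1 → 3 := fun h => h.kypForm_nonneg hs hP.isSelfAdjoint h𝒮
  tfae_have 3 → 1 := fun h T hT x u y hc =>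
    hc.dissipationInequality hs hP.isSelfAdjoint h𝒮 h hT
  tfae_have 3 → 2 := fun h => ⟨⊤, fun w ε hε => ⟨w, trivial, by simpa [SysNode.graphNorm]⟩,
    fun w _ => h w⟩
  tfae_have 2 → 3 := fun ⟨_, hW, h⟩ => SysNode.kypForm_nonneg_of_dense N P hs hW h
  tfae_have 3 → 4 := SysNode.exists_kypForm_factorization N hQ hR
  tfae_have 4 → 3 := by
    rintro ⟨Z, _, _, _, KL, -, -, h⟩ w
    rw [h w]
    positivity
  tfae_have 1 → 5 := fun h T hT x u y hg =>
    h.dissipationInequality_of_isGeneralizedTrajectory hcont hT hg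
  tfae_have 5 → 1 := fun h T hT x u y hc => h T hT x u y hc.isGeneralizedTrajectory
  tfae_finish
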